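/- Let $\mathbb{O}$ be the real algebra of octonions with its standard involution, and let $\mathbb{A} = M_3(\mathbb{O})_{sa}$ be the Albert algebra: the real vector space of self-adjoint $3\times 3$ matrices over $\mathbb{O}$ with the Jordan product $x\circ y = \tfrac12(xy+yx)$, whose unit element $1$ is the identity matrix. Then $\mathbb{A}$ cannot be generated as a real Jordan algebra by two projections, a third element and the unit element. That is, for all $a, p, q\in\mathbb{A}$ with $p\circ p = p$ and $q\circ q = q$, the smallest real linear subspace of $\mathbb{A}$ that contains $1, a, p, q$ and is closed under $\circ$ is not all of $\mathbb{A}$. -/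

import Mathlib

noncomputable section

/-- The real algebra of octonions, as the Cayley–Dickson double of the quaternions: the pair
`(a, b)` stands for `a + b ℓ`. A basis is `1`, together with the seven imaginary units
`i, j, k, ℓ, i ℓ, j ℓ, k ℓ`. -/
@[ext]
structure Octonion where
  /-- the component in the quaternions -/
  fst : Quaternion ℝ
  /-- the coefficient of `ℓ` -/
  snd : Quaternion ℝ

namespace Octonion

instance : Zero Octonion := ⟨⟨0, 0⟩⟩
instance : One Octonion := ⟨⟨1, 0⟩⟩
instance : Add Octonion := ⟨fun x y => ⟨x.fst + y.fst, x.snd + y.snd⟩⟩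
instance : Neg Octonion := ⟨fun x => ⟨-x.fst, -x.snd⟩⟩
instance : SMul ℝ Octonion := ⟨fun r x => ⟨r • x.fst, r • x.snd⟩⟩

/-- The Cayley–Dickson product `(a, b) (c, d) = (a c - d* b, d a + b c*)`. -/
instance : Mul Octonion :=
  ⟨fun x y => ⟨x.fst * y.fst - star y.snd * x.snd, y.snd * x.fst + x.snd * star y.fst⟩⟩

/-- The standard involution `(a, b)* = (a*, -b)`: it fixes `1` and negates the imaginary units. -/
instance : Star Octonion := ⟨fun x => ⟨star x.fst, -x.snd⟩⟩

@[simp] theorem zero_fst : (0 : Octonion).fst = 0 := rfl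
@[simp] theorem zero_snd : (0 : Octonion).snd = 0 := rfl
@[simp] theorem one_fst : (1 : Octonion).fst = 1 := rfl
@[simp] theorem one_snd : (1 : Octonion).snd = 0 := rfl
@[simp] theorem add_fst (x y : Octonion) : (x + y).fst = x.fst + y.fst := rfl
@[simp] theorem add_snd (x y : Octonion) : (x + y).snd = x.snd + y.snd := rfl
@[simp] theorem neg_fst (x : Octonion) : (-x).fst = -x.fst := rfl
@[simp] theorem neg_snd (x : Octonion) : (-x).snd = -x.snd := rfl
@[simp] theorem smul_fst (r : ℝ) (x : Octonion) : (r • x).fst = r • x.fst := rfl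
@[simp] theorem smul_snd (r : ℝ) (x : Octonion) : (r • x).snd = r • x.snd := rfl
@[simp] theorem mul_fst (x y : Octonion) :
    (x * y).fst = x.fst * y.fst - star y.snd * x.snd := rfl
@[simp] theorem mul_snd (x y : Octonion) :
    (x * y).snd = y.snd * x.fst + x.snd * star y.fst := rfl
@[simp] theorem star_fst (x : Octonion) : (star x).fst = star x.fst := rfl
@[simp] theorem star_snd (x : Octonion) : (star x).snd = -x.snd := rfl

instance : AddCommGroup Octonion where
  add_assoc x y z := by ext1 <;> simp [add_assoc]
  zero_add x := by ext1 <;> simp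
  add_zero x := by ext1 <;> simp
  add_comm x y := by ext1 <;> simp [add_comm]
  neg_add_cancel x := by ext1 <;> simp
  nsmul := nsmulRec
  zsmul := zsmulRec

instance : NonAssocRing Octonion where
  left_distrib x y z := by ext1 <;> simp [mul_add, add_mul] <;> abel
  right_distrib x y z := by ext1 <;> simp [mul_add, add_mul] <;> abel
  zero_mul x := by ext1 <;> simp
  mul_zero x := by ext1 <;> simp
  one_mul x := by ext1 <;> simp
  mul_one x := by ext1 <;> simp

instance : Module ℝ Octonion where
  one_smul x := by ext1 <;> simp
  mul_smul r s x := by ext1 <;> simp [mul_smul]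
  smul_zero r := by ext1 <;> simp
  smul_add r x y := by ext1 <;> simp
  add_smul r s x := by ext1 <;> simp [add_smul]
  zero_smul x := by ext1 <;> simp

instance : IsScalarTower ℝ Octonion Octonion where
  smul_assoc r x y := by ext1 <;> simp [smul_sub]

instance : SMulCommClass ℝ Octonion Octonion where
  smul_comm r x y := by ext1 <;> simp [smul_sub]

instance : StarRing Octonion where
  star_involutive x := by ext1 <;> simp
  star_mul x y := by ext1 <;> simp [sub_eq_add_neg, add_comm]
  star_add x y := by ext1 <;> simp [add_comm]

instance : StarModule ℝ Octonion where
  star_smul r x := by ext1 <;> simp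

end Octonion

/-- The Albert algebra `M₃(𝕆)_sa`: the self-adjoint 3 × 3 matrices over the octonions, that is,
the matrices `x` that equal their conjugate transpose `star x`. -/
def Albert : Type := selfAdjoint (Matrix (Fin 3) (Fin 3) Octonion)

namespace Albert

/-- The underlying matrix. -/
def toMatrix (x : Albert) : Matrix (Fin 3) (Fin 3) Octonion := x.1

@[ext]
theorem ext {x y : Albert} (h : x.toMatrix = y.toMatrix) : x = y := Subtype.ext h

theorem star_toMatrix (x : Albert) : star x.toMatrix = x.toMatrix := x.2

instance : AddCommGroup Albert :=
  inferInstanceAs (AddCommGroup (selfAdjoint (Matrix (Fin 3) (Fin 3) Octonion)))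

instance : Module ℝ Albert :=
  inferInstanceAs (Module ℝ (selfAdjoint (Matrix (Fin 3) (Fin 3) Octonion)))

/-- The unit is the identity matrix. -/
instance : One Albert := ⟨⟨1, Matrix.conjTranspose_one⟩⟩

/-- The Jordan product `x ∘ y = (x y + y x) / 2`, with the matrix products on the right. -/
instance : Mul Albert :=
  ⟨fun x y => ⟨(1 / 2 : ℝ) • (x.toMatrix * y.toMatrix + y.toMatrix * x.toMatrix), by
    rw [selfAdjoint.mem_iff, star_smul, star_add, star_mul, star_mul, star_toMatrix,
      star_toMatrix, add_comm, star_trivial]⟩⟩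

@[simp] theorem toMatrix_zero : (0 : Albert).toMatrix = 0 := rfl
@[simp] theorem toMatrix_one : (1 : Albert).toMatrix = 1 := rfl
@[simp] theorem toMatrix_add (x y : Albert) : (x + y).toMatrix = x.toMatrix + y.toMatrix := rfl
@[simp] theorem toMatrix_smul (r : ℝ) (x : Albert) : (r • x).toMatrix = r • x.toMatrix := rfl
@[simp] theorem toMatrix_mul (x y : Albert) : (x * y).toMatrix =
    (1 / 2 : ℝ) • (x.toMatrix * y.toMatrix + y.toMatrix * x.toMatrix) := rfl

instance : NonAssocCommRing Albert where
  left_distrib x y z := by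
    ext1; simp only [toMatrix_mul, toMatrix_add, mul_add, add_mul, smul_add]; abel
  right_distrib x y z := by
    ext1; simp only [toMatrix_mul, toMatrix_add, mul_add, add_mul, smul_add]; abel
  zero_mul x := by ext1; simp
  mul_zero x := by ext1; simp
  one_mul x := by
    ext1
    rw [toMatrix_mul, toMatrix_one, one_mul, mul_one, ← two_smul ℝ, smul_smul]
    norm_num
  mul_one x := by
    ext1
    rw [toMatrix_mul, toMatrix_one, one_mul, mul_one, ← two_smul ℝ, smul_smul]
    norm_num
  mul_comm x y := by ext1; rw [toMatrix_mul, toMatrix_mul, add_comm]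

instance : IsScalarTower ℝ Albert Albert where
  smul_assoc r x y := by
    ext1
    simp only [smul_eq_mul, toMatrix_mul, toMatrix_smul, smul_mul_assoc, mul_smul_comm,
      ← smul_add]
    rw [smul_comm]

instance : SMulCommClass ℝ Albert Albert where
  smul_comm r x y := by
    ext1
    simp only [smul_eq_mul, toMatrix_mul, toMatrix_smul, smul_mul_assoc, mul_smul_comm,
      ← smul_add]
    rw [smul_comm]

end Albert

end

/-!
Write an element of the Albert algebra as three real diagonal entries and three octonions. The
quadratic adjoint satisfies `x ∘ x = x# + tr(x) x - tr(x#) 1`, so a subspace that contains `1` is a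
Jordan subalgebra as soon as it is stable under `x ↦ x#`.

Every projection lies in the span of `1` and a projection of trace one (`exists_trace_one`), and a
projection `p` of trace one has `p# = 0`. If two such projections coincide, one of them can be
replaced by any other. So the task is to enclose `1`, `a` and two different rank one projections
`p`, `q` in a proper subspace `B` with a partner `B'` such that the adjoint exchanges `B` and `B'`
(`Caged`). As `1` lies in `B`, the two subspaces coincide (`adjoin_ne_top_of_caged`).

The advantage of pairs `(B, B')` is that they can be transported not only along automorphisms but
along all linear maps `g` with `(g x)# = g' (x#)` for a dual map `g'` (`IsSharpPair`), hence along
the transvections `x ↦ t x t*` with `t` an elementary octonion matrix. Row and column operations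
thus move `p` and `q` to multiples of the first two diagonal matrix units, and then clear two of the
three off-diagonal entries of the image `h` of `1`. This needs the last diagonal entry of `h` to be
nonzero, which holds since the determinant polarized at `p`, `q` and `h` is an invariant
(`Nondegenerate`).

Now only four octonions matter: `x` and `y` in position `(0, 1)`, coming from `h` and `a`, and the
entries `s` and `w` of `a` in positions `(1, 2)` and `(2, 0)`. One may assume `x ≠ 0`, so that
`w = (x t)*` for some `t`. With `J r = x* (y r)`, the subspace `S` spanned by `s`, `t`, `J s` and
`J t` is stable under `J`, and it has dimension at most four. The product
`((x a) b*) c` is alternating modulo `x S` for `a`, `b`, `c` in `S`, and it lies in `x S` when two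
arguments are `r` and `J r`. Any three of the four spanning vectors contain such a pair, so that it
always lies in `x S` (`mul_star_mul_mem_map_mulLeft`). Consequently `S`, `(x S)*` and
`{v | v S ⊆ x S}` are stable under the products that occur in the adjoint
(`exists_stable_triple`), and the elements with off-diagonal entries in these three subspaces form
the required proper subspace.
-/

noncomputable section

/-! ### The inner product of octonions -/

namespace Octonion

/-- The Euclidean inner product of octonions, in the basis of `Octonion`. -/
def ip (x y : Octonion) : ℝ :=
  x.fst.re * y.fst.re + x.fst.imI * y.fst.imI + x.fst.imJ * y.fst.imJ + x.fst.imK * y.fst.imK +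
  (x.snd.re * y.snd.re + x.snd.imI * y.snd.imI + x.snd.imJ * y.snd.imJ + x.snd.imK * y.snd.imK)

theorem ip_comm (x y : Octonion) : ip x y = ip y x := by
  simp only [ip]; ring

@[simp] theorem ip_add_left (x y z : Octonion) : ip (x + y) z = ip x z + ip y z := by
  simp [ip]; ring

@[simp] theorem ip_add_right (x y z : Octonion) : ip x (y + z) = ip x y + ip x z := by
  simp [ip]; ring

@[simp] theorem ip_smul_left (r : ℝ) (x y : Octonion) : ip (r • x) y = r * ip x y := by
  simp [ip]; ring

@[simp] theorem ip_smul_right (r : ℝ) (x y : Octonion) : ip x (r • y) = r * ip x y := by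
  simp [ip]; ring

@[simp] theorem ip_neg_left (x y : Octonion) : ip (-x) y = -ip x y := by
  simp [ip]; ring

@[simp] theorem ip_neg_right (x y : Octonion) : ip x (-y) = -ip x y := by
  simp [ip]; ring

@[simp] theorem ip_sub_left (x y z : Octonion) : ip (x - y) z = ip x z - ip y z := by
  rw [sub_eq_add_neg, ip_add_left, ip_neg_left, sub_eq_add_neg]

@[simp] theorem ip_sub_right (x y z : Octonion) : ip x (y - z) = ip x y - ip x z := by
  rw [sub_eq_add_neg, ip_add_right, ip_neg_right, sub_eq_add_neg]

@[simp] theorem ip_zero_left (x : Octonion) : ip 0 x = 0 := by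
  simpa using ip_smul_left 0 0 x

@[simp] theorem ip_zero_right (x : Octonion) : ip x 0 = 0 := by
  simpa using ip_smul_right 0 x 0

@[simp] theorem ip_star_star (x y : Octonion) : ip (star x) (star y) = ip x y := by
  simp [ip]

theorem ip_self_nonneg (x : Octonion) : 0 ≤ ip x x := by
  simp only [ip, ← sq]; positivity

theorem ip_self_eq_zero {x : Octonion} : ip x x = 0 ↔ x = 0 := by
  refine ⟨fun h => ?_, fun h => by simp [h]⟩
  have key : Quaternion.normSq x.fst + Quaternion.normSq x.snd = 0 := by
    rw [Quaternion.normSq_def', Quaternion.normSq_def']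
    refine Eq.trans ?_ h
    rw [ip]; ring
  have h₁ := Quaternion.normSq_nonneg (a := x.fst)
  have h₂ := Quaternion.normSq_nonneg (a := x.snd)
  have e₁ : x.fst = 0 := Quaternion.normSq_eq_zero.mp (by linarith)
  have e₂ : x.snd = 0 := Quaternion.normSq_eq_zero.mp (by linarith)
  exact Octonion.ext e₁ e₂

theorem mul_star_add (x y : Octonion) :
    x * star y + y * star x = (2 * ip x y) • (1 : Octonion) := by
  ext <;> simp [ip, Quaternion.re_one, Quaternion.imI_one, Quaternion.imJ_one,
    Quaternion.imK_one] <;> ring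

set_option maxHeartbeats 1000000 in
/-- The linearized left alternative law. -/
theorem star_mul_mul_add (x y z : Octonion) :
    star x * (y * z) + star y * (x * z) = (2 * ip x y) • z := by
  ext <;> simp [ip] <;> ring

/-- The linearized right alternative law. -/
theorem mul_mul_star_add (z x y : Octonion) :
    (z * x) * star y + (z * y) * star x = (2 * ip x y) • z := by
  have h := congrArg star (star_mul_mul_add (star x) (star y) (star z))
  simpa [add_comm, -star_mul, star_mul x (_ * _), star_mul y (_ * _), star_mul (star _) (star _)]
    using h

theorem ip_mul_self (x y : Octonion) : ip (x * y) (x * y) = ip x x * ip y y := by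
  simp [ip]; ring

theorem ip_mul_star (x y z : Octonion) : ip x (star (y * z)) = ip z (star (x * y)) := by
  simp [ip]; ring

theorem star_mul_mul_self (x z : Octonion) : star x * (x * z) = ip x x • z := by
  have h := star_mul_mul_add x x z
  rw [← two_smul ℝ, mul_smul] at h
  exact smul_right_injective _ (two_ne_zero' ℝ) h

theorem mul_mul_star_self (z x : Octonion) : (z * x) * star x = ip x x • z := by
  have h := mul_mul_star_add z x x
  rw [← two_smul ℝ, mul_smul] at h
  exact smul_right_injective _ (two_ne_zero' ℝ) h

theorem mul_star_self (x : Octonion) : x * star x = ip x x • (1 : Octonion) := by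
  simpa using mul_mul_star_self 1 x

theorem star_mul_self (x : Octonion) : star x * x = ip x x • (1 : Octonion) := by
  simpa using star_mul_mul_self x 1

theorem ip_one_right (x : Octonion) : ip x 1 = x.fst.re := by
  simp [ip, Quaternion.re_one, Quaternion.imI_one, Quaternion.imJ_one, Quaternion.imK_one,
    Quaternion.re_zero, Quaternion.imI_zero, Quaternion.imJ_zero, Quaternion.imK_zero]

theorem ip_self_pos {x : Octonion} (h : x ≠ 0) : 0 < ip x x :=
  (ip_self_nonneg x).lt_of_ne fun e => h (ip_self_eq_zero.mp e.symm)

theorem eq_smul_one_of_star_eq {z : Octonion} (h : z = star z) :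
    z = z.fst.re • (1 : Octonion) := by
  have h₁ : (2 : ℝ) • z = (2 * z.fst.re) • (1 : Octonion) := by
    have := mul_star_add z 1
    rw [star_one, mul_one, one_mul, ← h, ← two_smul ℝ] at this
    rw [this, ip_one_right]
  rw [mul_smul] at h₁
  exact smul_right_injective _ (two_ne_zero' ℝ) h₁

theorem coeff_mul_eq_norm {x y z : Octonion} {a b : ℝ} (hx : x ≠ 0)
    (h₁ : star (y * z) = a • x) (h₂ : star (x * y) = b • z) : b * a = ip y y := by
  have h := mul_mul_star_self x y
  rw [← star_star (x * y), h₂, star_smul, smul_mul_assoc, ← star_mul, h₁, smul_smul] at h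
  exact smul_left_injective ℝ hx h

end Octonion

/-! ### Coordinates on the Albert algebra and the adjoint -/

namespace Albert
open Octonion

/-- The first diagonal entry of `x`, a real number. -/
def d₁ (x : Albert) : ℝ := (x.toMatrix 0 0).fst.re
/-- The second diagonal entry of `x`, a real number. -/
def d₂ (x : Albert) : ℝ := (x.toMatrix 1 1).fst.re
/-- The third diagonal entry of `x`, a real number. -/
def d₃ (x : Albert) : ℝ := (x.toMatrix 2 2).fst.re
/-- The off-diagonal entry of `x` opposite to the first diagonal entry. -/
def o₁ (x : Albert) : Octonion := x.toMatrix 1 2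
/-- The off-diagonal entry of `x` opposite to the second diagonal entry. -/
def o₂ (x : Albert) : Octonion := x.toMatrix 2 0
/-- The off-diagonal entry of `x` opposite to the third diagonal entry. -/
def o₃ (x : Albert) : Octonion := x.toMatrix 0 1

theorem toMatrix_eq_star (x : Albert) (i j : Fin 3) : x.toMatrix i j = star (x.toMatrix j i) :=
  (congrFun (congrFun x.star_toMatrix i) j).symm

theorem toMatrix_zero_zero (x : Albert) : x.toMatrix 0 0 = x.d₁ • (1 : Octonion) :=
  eq_smul_one_of_star_eq (x.toMatrix_eq_star 0 0)
theorem toMatrix_one_one (x : Albert) : x.toMatrix 1 1 = x.d₂ • (1 : Octonion) :=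
  eq_smul_one_of_star_eq (x.toMatrix_eq_star 1 1)
theorem toMatrix_two_two (x : Albert) : x.toMatrix 2 2 = x.d₃ • (1 : Octonion) :=
  eq_smul_one_of_star_eq (x.toMatrix_eq_star 2 2)

theorem ext_coords {x y : Albert} (h₁ : x.d₁ = y.d₁) (h₂ : x.d₂ = y.d₂) (h₃ : x.d₃ = y.d₃)
    (k₁ : x.o₁ = y.o₁) (k₂ : x.o₂ = y.o₂) (k₃ : x.o₃ = y.o₃) : x = y := by
  have e₁ : x.toMatrix 0 0 = y.toMatrix 0 0 := by rw [toMatrix_zero_zero, toMatrix_zero_zero, h₁]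
  have e₂ : x.toMatrix 1 1 = y.toMatrix 1 1 := by rw [toMatrix_one_one, toMatrix_one_one, h₂]
  have e₃ : x.toMatrix 2 2 = y.toMatrix 2 2 := by rw [toMatrix_two_two, toMatrix_two_two, h₃]
  have f₁ : x.toMatrix 2 1 = y.toMatrix 2 1 := by
    rw [toMatrix_eq_star x, toMatrix_eq_star y]; exact congrArg star k₁
  have f₂ : x.toMatrix 0 2 = y.toMatrix 0 2 := by
    rw [toMatrix_eq_star x, toMatrix_eq_star y]; exact congrArg star k₂
  have f₃ : x.toMatrix 1 0 = y.toMatrix 1 0 := by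
    rw [toMatrix_eq_star x, toMatrix_eq_star y]; exact congrArg star k₃
  ext1
  funext i j
  fin_cases i <;> fin_cases j <;> assumption

/-- The element with the given diagonal entries and the given octonions in the positions
`(1, 2)`, `(2, 0)` and `(0, 1)`. -/
def ofCoords (a b c : ℝ) (x y z : Octonion) : Albert :=
  ⟨!![a • 1, z, star y; star z, b • 1, x; y, star x, c • 1], by
    rw [selfAdjoint.mem_iff]
    ext1 i j
    fin_cases i <;> fin_cases j <;> simp [Matrix.star_apply]⟩

section
variable (a b c : ℝ) (x y z : Octonion)
@[simp] theorem d₁_ofCoords : (ofCoords a b c x y z).d₁ = a :=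
  (mul_one a : a * (1 : Quaternion ℝ).re = a)
@[simp] theorem d₂_ofCoords : (ofCoords a b c x y z).d₂ = b :=
  (mul_one b : b * (1 : Quaternion ℝ).re = b)
@[simp] theorem d₃_ofCoords : (ofCoords a b c x y z).d₃ = c :=
  (mul_one c : c * (1 : Quaternion ℝ).re = c)
@[simp] theorem o₁_ofCoords : (ofCoords a b c x y z).o₁ = x := rfl
@[simp] theorem o₂_ofCoords : (ofCoords a b c x y z).o₂ = y := rfl
@[simp] theorem o₃_ofCoords : (ofCoords a b c x y z).o₃ = z := rfl
end

section
variable (r : ℝ) (x y : Albert)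
@[simp] theorem d₁_add : (x + y).d₁ = x.d₁ + y.d₁ := rfl
@[simp] theorem d₂_add : (x + y).d₂ = x.d₂ + y.d₂ := rfl
@[simp] theorem d₃_add : (x + y).d₃ = x.d₃ + y.d₃ := rfl
@[simp] theorem o₁_add : (x + y).o₁ = x.o₁ + y.o₁ := rfl
@[simp] theorem o₂_add : (x + y).o₂ = x.o₂ + y.o₂ := rfl
@[simp] theorem o₃_add : (x + y).o₃ = x.o₃ + y.o₃ := rfl
@[simp] theorem d₁_smul : (r • x).d₁ = r * x.d₁ := rfl
@[simp] theorem d₂_smul : (r • x).d₂ = r * x.d₂ := rfl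
@[simp] theorem d₃_smul : (r • x).d₃ = r * x.d₃ := rfl
@[simp] theorem o₁_smul : (r • x).o₁ = r • x.o₁ := rfl
@[simp] theorem o₂_smul : (r • x).o₂ = r • x.o₂ := rfl
@[simp] theorem o₃_smul : (r • x).o₃ = r • x.o₃ := rfl
@[simp] theorem d₁_neg : (-x).d₁ = -x.d₁ := rfl
@[simp] theorem d₂_neg : (-x).d₂ = -x.d₂ := rfl
@[simp] theorem d₃_neg : (-x).d₃ = -x.d₃ := rfl
@[simp] theorem o₁_neg : (-x).o₁ = -x.o₁ := rfl
@[simp] theorem o₂_neg : (-x).o₂ = -x.o₂ := rfl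
@[simp] theorem o₃_neg : (-x).o₃ = -x.o₃ := rfl
@[simp] theorem d₁_sub : (x - y).d₁ = x.d₁ - y.d₁ := by simp [sub_eq_add_neg]
@[simp] theorem d₂_sub : (x - y).d₂ = x.d₂ - y.d₂ := by simp [sub_eq_add_neg]
@[simp] theorem d₃_sub : (x - y).d₃ = x.d₃ - y.d₃ := by simp [sub_eq_add_neg]
@[simp] theorem o₁_sub : (x - y).o₁ = x.o₁ - y.o₁ := by simp [sub_eq_add_neg]
@[simp] theorem o₂_sub : (x - y).o₂ = x.o₂ - y.o₂ := by simp [sub_eq_add_neg]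
@[simp] theorem o₃_sub : (x - y).o₃ = x.o₃ - y.o₃ := by simp [sub_eq_add_neg]
@[simp] theorem d₁_zero : (0 : Albert).d₁ = 0 := rfl
@[simp] theorem d₂_zero : (0 : Albert).d₂ = 0 := rfl
@[simp] theorem d₃_zero : (0 : Albert).d₃ = 0 := rfl
@[simp] theorem o₁_zero : (0 : Albert).o₁ = 0 := rfl
@[simp] theorem o₂_zero : (0 : Albert).o₂ = 0 := rfl
@[simp] theorem o₃_zero : (0 : Albert).o₃ = 0 := rfl
@[simp] theorem d₁_one : (1 : Albert).d₁ = 1 := rfl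
@[simp] theorem d₂_one : (1 : Albert).d₂ = 1 := rfl
@[simp] theorem d₃_one : (1 : Albert).d₃ = 1 := rfl
@[simp] theorem o₁_one : (1 : Albert).o₁ = 0 := rfl
@[simp] theorem o₂_one : (1 : Albert).o₂ = 0 := rfl
@[simp] theorem o₃_one : (1 : Albert).o₃ = 0 := rfl
end

/-- The adjoint `x#`, the quadratic map with `x ∘ x# = det x • 1`. -/
def sharp (x : Albert) : Albert :=
  ofCoords (x.d₂ * x.d₃ - ip x.o₁ x.o₁) (x.d₃ * x.d₁ - ip x.o₂ x.o₂) (x.d₁ * x.d₂ - ip x.o₃ x.o₃)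
    (star (x.o₂ * x.o₃) - x.d₁ • x.o₁) (star (x.o₃ * x.o₁) - x.d₂ • x.o₂)
    (star (x.o₁ * x.o₂) - x.d₃ • x.o₃)

/-- The trace form `(x, y) ↦ tr (x ∘ y)`. -/
def form (x y : Albert) : ℝ :=
  x.d₁ * y.d₁ + x.d₂ * y.d₂ + x.d₃ * y.d₃ + 2 * (ip x.o₁ y.o₁ + ip x.o₂ y.o₂ + ip x.o₃ y.o₃)

theorem mul_self_toMatrix (x : Albert) (i j : Fin 3) : (x * x).toMatrix i j =
    x.toMatrix i 0 * x.toMatrix 0 j + x.toMatrix i 1 * x.toMatrix 1 j +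
      x.toMatrix i 2 * x.toMatrix 2 j := by
  rw [toMatrix_mul, ← two_smul ℝ, smul_smul]
  simp [Matrix.mul_apply, Fin.sum_univ_three]

theorem d₁_mul_self (x : Albert) :
    (x * x).d₁ = x.d₁ * x.d₁ + ip x.o₂ x.o₂ + ip x.o₃ x.o₃ := by
  have h : (x * x).toMatrix 0 0 =
      (x.d₁ * x.d₁ + ip x.o₂ x.o₂ + ip x.o₃ x.o₃) • (1 : Octonion) := by
    rw [mul_self_toMatrix, toMatrix_zero_zero, toMatrix_eq_star x 1 0, toMatrix_eq_star x 0 2]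
    change x.d₁ • (1 : Octonion) * x.d₁ • (1 : Octonion) + x.o₃ * star x.o₃ + star x.o₂ * x.o₂ = _
    rw [mul_star_self, star_mul_self, smul_mul_smul_comm, mul_one]
    module
  rw [d₁, h]
  exact mul_one (_ : ℝ)

theorem d₂_mul_self (x : Albert) :
    (x * x).d₂ = x.d₂ * x.d₂ + ip x.o₃ x.o₃ + ip x.o₁ x.o₁ := by
  have h : (x * x).toMatrix 1 1 =
      (x.d₂ * x.d₂ + ip x.o₃ x.o₃ + ip x.o₁ x.o₁) • (1 : Octonion) := by
    rw [mul_self_toMatrix, toMatrix_one_one, toMatrix_eq_star x 2 1, toMatrix_eq_star x 1 0]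
    change star x.o₃ * x.o₃ + x.d₂ • (1 : Octonion) * x.d₂ • (1 : Octonion) + x.o₁ * star x.o₁ = _
    rw [mul_star_self, star_mul_self, smul_mul_smul_comm, mul_one]
    module
  rw [d₂, h]
  exact mul_one (_ : ℝ)

theorem d₃_mul_self (x : Albert) :
    (x * x).d₃ = x.d₃ * x.d₃ + ip x.o₁ x.o₁ + ip x.o₂ x.o₂ := by
  have h : (x * x).toMatrix 2 2 =
      (x.d₃ * x.d₃ + ip x.o₁ x.o₁ + ip x.o₂ x.o₂) • (1 : Octonion) := by
    rw [mul_self_toMatrix, toMatrix_two_two, toMatrix_eq_star x 0 2, toMatrix_eq_star x 2 1]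
    change x.o₂ * star x.o₂ + star x.o₁ * x.o₁ + x.d₃ • (1 : Octonion) * x.d₃ • (1 : Octonion) = _
    rw [mul_star_self, star_mul_self, smul_mul_smul_comm, mul_one]
    module
  rw [d₃, h]
  exact mul_one (_ : ℝ)

theorem o₁_mul_self (x : Albert) :
    (x * x).o₁ = (x.d₂ + x.d₃) • x.o₁ + star (x.o₂ * x.o₃) := by
  have h : (x * x).o₁ = _ := mul_self_toMatrix x 1 2
  rw [h, toMatrix_one_one, toMatrix_two_two, toMatrix_eq_star x 1 0, toMatrix_eq_star x 0 2,
    star_mul]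
  change star x.o₃ * star x.o₂ + x.d₂ • (1 : Octonion) * x.o₁ + x.o₁ * x.d₃ • (1 : Octonion) = _
  rw [smul_one_mul, mul_smul_one]
  module

theorem o₂_mul_self (x : Albert) :
    (x * x).o₂ = (x.d₃ + x.d₁) • x.o₂ + star (x.o₃ * x.o₁) := by
  have h : (x * x).o₂ = _ := mul_self_toMatrix x 2 0
  rw [h, toMatrix_two_two, toMatrix_zero_zero, toMatrix_eq_star x 2 1, toMatrix_eq_star x 1 0,
    star_mul]
  change x.o₂ * x.d₁ • (1 : Octonion) + star x.o₁ * star x.o₃ + x.d₃ • (1 : Octonion) * x.o₂ = _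
  rw [smul_one_mul, mul_smul_one]
  module

theorem o₃_mul_self (x : Albert) :
    (x * x).o₃ = (x.d₁ + x.d₂) • x.o₃ + star (x.o₁ * x.o₂) := by
  have h : (x * x).o₃ = _ := mul_self_toMatrix x 0 1
  rw [h, toMatrix_zero_zero, toMatrix_one_one, toMatrix_eq_star x 0 2, toMatrix_eq_star x 2 1,
    star_mul]
  change x.d₁ • (1 : Octonion) * x.o₃ + x.o₃ * x.d₂ • (1 : Octonion) + star x.o₂ * star x.o₁ = _
  rw [smul_one_mul, mul_smul_one]
  module

theorem mul_self_eq (x : Albert) :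
    x * x = sharp x + form x 1 • x - form (sharp x) 1 • 1 := by
  apply ext_coords
  · simp [d₁_mul_self, sharp, form]; ring
  · simp [d₂_mul_self, sharp, form]; ring
  · simp [d₃_mul_self, sharp, form]; ring
  · simp [o₁_mul_self, sharp, form]; module
  · simp [o₂_mul_self, sharp, form]; module
  · simp [o₃_mul_self, sharp, form]; module
end Albert

/-! ### Idempotents and reduction to rank one -/

namespace Albert
open Octonion

theorem form_add_left (x y z : Albert) : form (x + y) z = form x z + form y z := by
  simp [form]; ring

theorem form_sub_left (x y z : Albert) : form (x - y) z = form x z - form y z := by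
  simp [form]; ring

theorem form_one_one : form (1 : Albert) 1 = 3 := by
  simp [form]; norm_num

theorem form_self_pos {x : Albert} (h : x ≠ 0) : 0 < form x x := by
  have n₁ := ip_self_nonneg x.o₁
  have n₂ := ip_self_nonneg x.o₂
  have n₃ := ip_self_nonneg x.o₃
  have m₁ := mul_self_nonneg x.d₁
  have m₂ := mul_self_nonneg x.d₂
  have m₃ := mul_self_nonneg x.d₃
  by_contra hx
  rw [form] at hx
  refine h (ext_coords ?_ ?_ ?_ ?_ ?_ ?_)
  · exact mul_self_eq_zero.mp (by linarith)
  · exact mul_self_eq_zero.mp (by linarith)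
  · exact mul_self_eq_zero.mp (by linarith)
  · exact ip_self_eq_zero.mp (by linarith)
  · exact ip_self_eq_zero.mp (by linarith)
  · exact ip_self_eq_zero.mp (by linarith)

theorem form_sharp_one (x : Albert) : 2 * form (sharp x) 1 = form x 1 ^ 2 - form x x := by
  simp [form, sharp]; ring

theorem form_mul_self_one (x : Albert) : form (x * x) 1 = form x x := by
  simp [form, d₁_mul_self, d₂_mul_self, d₃_mul_self]; ring

/-- Idempotents of trace one have rank one. -/
theorem sharp_eq_zero_of_trace_eq_one {p : Albert} (hp : p * p = p) (ht : form p 1 = 1) :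
    sharp p = 0 := by
  have h := mul_self_eq p
  have hs := form_sharp_one p
  rw [← form_mul_self_one, hp, ht] at hs
  rw [hp, ht, show form (sharp p) 1 = 0 by linarith] at h
  simpa using h

theorem one_sub_mul_self {p : Albert} (hp : p * p = p) : (1 - p) * (1 - p) = 1 - p := by
  rw [mul_sub, mul_one, sub_mul, one_mul, hp]
  abel

/-- For an idempotent `p` of trace `t`, the adjoint is `(1 - t) p + (t (t - 1) / 2) 1`, so that
`p ∘ p#` being scalar forces `(t - 1) (t - 2) = 0` unless `p` is scalar. The proof reads this off an
off-diagonal entry that does not vanish; if there is none, the diagonal entries are `0` or `1`. -/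
theorem trace_of_mul_self_eq {p : Albert} (hp : p * p = p) :
    p = 0 ∨ p = 1 ∨ form p 1 = 1 ∨ form p 1 = 2 := by
  have e₁ := d₁_mul_self p
  have e₂ := d₂_mul_self p
  have e₃ := d₃_mul_self p
  have f₁ := o₁_mul_self p
  have f₂ := o₂_mul_self p
  have f₃ := o₃_mul_self p
  have hs := form_sharp_one p
  have hm := mul_self_eq p
  rw [← form_mul_self_one, hp] at hs
  rw [hp] at e₁ e₂ e₃ f₁ f₂ f₃ hm
  set t := form p 1 with ht
  have ht' : t = p.d₁ + p.d₂ + p.d₃ := by simp [ht, form]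
  have c₁ := congrArg d₁ hm
  have c₂ := congrArg d₂ hm
  have c₃ := congrArg d₃ hm
  set s := form (sharp p) 1
  simp only [sharp, d₁_ofCoords, d₂_ofCoords, d₃_ofCoords, d₁_add, d₂_add, d₃_add, d₁_sub, d₂_sub,
    d₃_sub, d₁_smul, d₂_smul, d₃_smul, d₁_one, d₂_one, d₃_one] at c₁ c₂ c₃
  have g₁ : star (p.o₂ * p.o₃) = (1 - t + p.d₁) • p.o₁ := by
    rw [ht', eq_sub_of_add_eq' f₁.symm]; module
  have g₂ : star (p.o₃ * p.o₁) = (1 - t + p.d₂) • p.o₂ := by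
    rw [ht', eq_sub_of_add_eq' f₂.symm]; module
  have g₃ : star (p.o₁ * p.o₂) = (1 - t + p.d₃) • p.o₃ := by
    rw [ht', eq_sub_of_add_eq' f₃.symm]; module
  have fin : (t - 1) * (t - 2) = 0 → p = 0 ∨ p = 1 ∨ t = 1 ∨ t = 2 := fun h => by
    rcases mul_eq_zero.mp h with h | h
    · exact Or.inr (Or.inr (Or.inl (by linarith)))
    · exact Or.inr (Or.inr (Or.inr (by linarith)))
  by_cases x₁ : p.o₁ = 0
  · by_cases x₂ : p.o₂ = 0
    · by_cases x₃ : p.o₃ = 0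
      · simp only [x₁, x₂, x₃, ip_zero_left, add_zero] at e₁ e₂ e₃
        have b : ∀ r : ℝ, r = r * r → r = 0 ∨ r = 1 := fun r h => by
          rcases mul_eq_zero.mp (show r * (r - 1) = 0 by linarith) with h | h
          · exact Or.inl h
          · exact Or.inr (by linarith)
        rcases b _ e₁ with b₁ | b₁ <;> rcases b _ e₂ with b₂ | b₂ <;> rcases b _ e₃ with b₃ | b₃
        · exact Or.inl (ext_coords b₁ b₂ b₃ x₁ x₂ x₃)
        on_goal 7 => exact Or.inr (Or.inl (ext_coords b₁ b₂ b₃ x₁ x₂ x₃))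
        all_goals
          apply fin
          rw [ht', b₁, b₂, b₃]
          norm_num
      · have := coeff_mul_eq_norm x₃ g₃ g₂
        exact fin (by linear_combination 2 * this + 2 * c₁ + 2 * (1 - t) * ht' - hs)
    · have := coeff_mul_eq_norm x₂ g₂ g₁
      exact fin (by linear_combination 2 * this + 2 * c₃ + 2 * (1 - t) * ht' - hs)
  · have := coeff_mul_eq_norm x₁ g₁ g₃
    exact fin (by linear_combination 2 * this + 2 * c₂ + 2 * (1 - t) * ht' - hs)

/-- `h`, `a`, `p` and `q` lie in a proper subspace that is stable under the adjoint up to a dual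
subspace: the adjoint maps each of `B` and `B'` into the other. Unlike a Jordan subalgebra, such a
pair is carried to another one by every linear map that preserves the adjoint up to a dual map. -/
def Caged (h a p q : Albert) : Prop :=
  ∃ B B' : Submodule ℝ Albert, B ≠ ⊤ ∧ (∀ x ∈ B, sharp x ∈ B') ∧ (∀ x ∈ B', sharp x ∈ B) ∧
    h ∈ B ∧ a ∈ B ∧ p ∈ B ∧ q ∈ B

theorem sharp_one : sharp 1 = 1 := by
  apply ext_coords <;> simp [sharp]

theorem sharp_add_one (x : Albert) : sharp (x + 1) = sharp x + (form x 1 • 1 - x) + 1 := by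
  apply ext_coords <;> simp [sharp, form]
  on_goal 1 => ring
  on_goal 1 => ring
  on_goal 1 => ring
  all_goals module

theorem le_of_sharp_mem {B B' : Submodule ℝ Albert} (h : ∀ x ∈ B, sharp x ∈ B')
    (h₁ : (1 : Albert) ∈ B) : B ≤ B' := by
  intro x hx
  have m₁ : (1 : Albert) ∈ B' := sharp_one ▸ h 1 h₁
  have h₂ := h _ (B.add_mem hx h₁)
  rw [sharp_add_one] at h₂
  have h₃ := B'.sub_mem (B'.sub_mem h₂ m₁) (h x hx)
  have h₄ := B'.sub_mem (B'.smul_mem (form x 1) m₁) h₃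
  convert h₄ using 1
  abel

/-- If one of the four elements is `1`, the two subspaces agree and form a Jordan subalgebra. -/
theorem adjoin_ne_top_of_caged {a p q p' q' : Albert} (h : Caged 1 a p' q')
    (hp : p ∈ Submodule.span ℝ {1, p'}) (hq : q ∈ Submodule.span ℝ {1, q'}) :
    NonUnitalAlgebra.adjoin ℝ ({1, a, p, q} : Set Albert) ≠ ⊤ := by
  obtain ⟨B, B', hB, h₁, h₂, m₁, ma, mp, mq⟩ := h
  have e : B = B' := le_antisymm (le_of_sharp_mem h₁ m₁)
    (le_of_sharp_mem h₂ (sharp_one ▸ h₁ 1 m₁))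
  subst e
  have sq : ∀ x ∈ B, x * x ∈ B := fun x hx => by
    rw [mul_self_eq]
    exact B.sub_mem (B.add_mem (h₁ x hx) (B.smul_mem _ hx)) (B.smul_mem _ m₁)
  have mul : ∀ x y, x ∈ B → y ∈ B → x * y ∈ B := fun x y hx hy => by
    have h := B.smul_mem (1 / 2 : ℝ)
      (B.sub_mem (B.sub_mem (sq _ (B.add_mem hx hy)) (sq x hx)) (sq y hy))
    have e : (x + y) * (x + y) - x * x - y * y = (2 : ℝ) • (x * y) := by
      rw [mul_add, add_mul, add_mul, mul_comm y x, two_smul]; abel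
    rw [e, smul_smul] at h
    norm_num at h
    exact h
  let A : NonUnitalSubalgebra ℝ Albert := { B with mul_mem' := fun {x y} => mul x y }
  have sp : ∀ z ∈ B, Submodule.span ℝ {1, z} ≤ B := fun z hz =>
    Submodule.span_le.mpr (Set.insert_subset m₁ (Set.singleton_subset_iff.mpr hz))
  have hA : ({1, a, p, q} : Set Albert) ⊆ A := by
    rintro z (rfl | rfl | rfl | rfl)
    exacts [m₁, ma, sp _ mp hp, sp _ mq hq]
  intro ht
  refine hB (eq_top_iff.mpr fun x _ => ?_)
  exact NonUnitalAlgebra.adjoin_le hA (ht ▸ NonUnitalAlgebra.mem_top : x ∈ _)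

/-- Rank one elements `p` and `q` such that `det` polarized at `p`, `q` and `h` does not vanish. -/
def Nondegenerate (h p q : Albert) : Prop :=
  sharp p = 0 ∧ sharp q = 0 ∧ form (sharp (p + q)) h ≠ 0

theorem nondegenerate_one {p q : Albert} (hp : p * p = p) (hq : q * q = q) (tp : form p 1 = 1)
    (tq : form q 1 = 1) (hpq : p ≠ q) : Nondegenerate 1 p q := by
  refine ⟨sharp_eq_zero_of_trace_eq_one hp tp, sharp_eq_zero_of_trace_eq_one hq tq, ?_⟩
  have h := form_sharp_one (p + q)
  have pos := form_self_pos (sub_ne_zero.mpr hpq)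
  have par : form (p + q) (p + q) + form (p - q) (p - q) = 2 * form p p + 2 * form q q := by
    simp [form]; ring
  rw [← form_mul_self_one p, ← form_mul_self_one q, hp, hq, tp, tq] at par
  rw [form_add_left, tp, tq] at h
  intro h0
  rw [h0] at h
  linarith

/-- Every idempotent lies in the span of `1` and an idempotent of trace one. -/
theorem exists_trace_one {p : Albert} (hp : p * p = p) :
    ∃ p', p' * p' = p' ∧ form p' 1 = 1 ∧ p ∈ Submodule.span ℝ {1, p'} := by
  have m : ∀ p' : Albert, (1 : Albert) ∈ Submodule.span ℝ {1, p'} ∧ p' ∈ Submodule.span ℝ {1, p'} :=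
    fun p' => ⟨Submodule.subset_span (by simp), Submodule.subset_span (by simp)⟩
  have he : (ofCoords 1 0 0 0 0 0) * (ofCoords 1 0 0 0 0 0) = ofCoords 1 0 0 0 0 0 := by
    apply ext_coords <;> simp [d₁_mul_self, d₂_mul_self, d₃_mul_self, o₁_mul_self, o₂_mul_self,
      o₃_mul_self]
  have te : form (ofCoords 1 0 0 0 0 0) 1 = 1 := by simp [form]
  rcases trace_of_mul_self_eq hp with h | h | h | h
  · exact ⟨_, he, te, by rw [h]; exact Submodule.zero_mem _⟩
  · exact ⟨_, he, te, by rw [h]; exact (m _).1⟩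
  · exact ⟨p, hp, h, (m p).2⟩
  · refine ⟨1 - p, one_sub_mul_self hp, ?_, ?_⟩
    · rw [form_sub_left, form_one_one, h]; norm_num
    · have := Submodule.sub_mem _ (m (1 - p)).1 (m (1 - p)).2
      rwa [sub_sub_cancel] at this

theorem exists_ne_trace_one (p : Albert) : ∃ q, q * q = q ∧ form q 1 = 1 ∧ p ≠ q := by
  by_cases h : p = ofCoords 1 0 0 0 0 0
  · refine ⟨ofCoords 0 1 0 0 0 0, ?_, by simp [form], fun e => ?_⟩
    · apply ext_coords <;> simp [d₁_mul_self, d₂_mul_self, d₃_mul_self, o₁_mul_self, o₂_mul_self,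
        o₃_mul_self]
    · simpa using congrArg d₁ (h.symm.trans e)
  · refine ⟨_, ?_, ?_, h⟩
    · apply ext_coords <;> simp [d₁_mul_self, d₂_mul_self, d₃_mul_self, o₁_mul_self, o₂_mul_self,
        o₃_mul_self]
    · simp [form]

theorem adjoin_ne_top_of_forall_caged
    (H : ∀ h a p q : Albert, Nondegenerate h p q → Caged h a p q)
    (a p q : Albert) (hp : p * p = p) (hq : q * q = q) :
    NonUnitalAlgebra.adjoin ℝ ({1, a, p, q} : Set Albert) ≠ ⊤ := by
  obtain ⟨p', hp', tp, mp⟩ := exists_trace_one hp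
  obtain ⟨q', hq', tq, mq⟩ := exists_trace_one hq
  by_cases e : p' = q'
  · -- The second idempotent is redundant and can be replaced by any other one.
    obtain ⟨r, hr, tr, ne⟩ := exists_ne_trace_one p'
    obtain ⟨B, B', hB, h₁, h₂, m₁, ma, mp', -⟩ := H 1 a p' r (nondegenerate_one hp' hr tp tr ne)
    exact adjoin_ne_top_of_caged ⟨B, B', hB, h₁, h₂, m₁, ma, mp', e ▸ mp'⟩ mp mq
  · exact adjoin_ne_top_of_caged (H 1 a p' q' (nondegenerate_one hp' hq' tp tq e)) mp mq

end Albert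

/-! ### Linear maps preserving the adjoint up to a dual map -/

namespace Albert
open Octonion

/-- `g` is onto, it preserves the adjoint up to `g'` and conversely, and `g'` is dual to `g` for the
trace form. Such maps preserve the determinant. -/
structure IsSharpPair (g g' : Albert →ₗ[ℝ] Albert) : Prop where
  surjective : Function.Surjective g
  sharp_apply : ∀ x, sharp (g x) = g' (sharp x)
  sharp_apply' : ∀ x, sharp (g' x) = g (sharp x)
  form_apply : ∀ x y, form (g' x) (g y) = form x y

theorem IsSharpPair.comp {f f' g g' : Albert →ₗ[ℝ] Albert} (hf : IsSharpPair f f')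
    (hg : IsSharpPair g g') : IsSharpPair (f ∘ₗ g) (f' ∘ₗ g') where
  surjective := hf.surjective.comp hg.surjective
  sharp_apply x := (hf.sharp_apply _).trans (congrArg f' (hg.sharp_apply x))
  sharp_apply' x := (hf.sharp_apply' _).trans (congrArg f (hg.sharp_apply' x))
  form_apply x y := (hf.form_apply _ _).trans (hg.form_apply x y)

theorem IsSharpPair.caged {g g' : Albert →ₗ[ℝ] Albert} (hg : IsSharpPair g g') {h a p q : Albert}
    (H : Caged (g h) (g a) (g p) (g q)) : Caged h a p q := by
  obtain ⟨B, B', hB, h₁, h₂, m⟩ := H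
  refine ⟨B.comap g, B'.comap g', fun e => hB ?_, fun x hx => ?_, fun x hx => ?_, m⟩
  · rw [← Submodule.map_comap_eq_of_surjective hg.surjective B, e, Submodule.map_top,
      LinearMap.range_eq_top.mpr hg.surjective]
  · rw [Submodule.mem_comap, ← hg.sharp_apply]
    exact h₁ _ hx
  · rw [Submodule.mem_comap, ← hg.sharp_apply']
    exact h₂ _ hx

theorem IsSharpPair.nondegenerate {g g' : Albert →ₗ[ℝ] Albert} (hg : IsSharpPair g g')
    {h p q : Albert} (H : Nondegenerate h p q) : Nondegenerate (g h) (g p) (g q) := by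
  refine ⟨?_, ?_, ?_⟩
  · rw [hg.sharp_apply, H.1, map_zero]
  · rw [hg.sharp_apply, H.2.1, map_zero]
  · rw [← map_add, hg.sharp_apply, hg.form_apply]
    exact H.2.2

/-- The cyclic shift of the three indices. -/
def rot : Albert →ₗ[ℝ] Albert where
  toFun x := ofCoords x.d₂ x.d₃ x.d₁ x.o₂ x.o₃ x.o₁
  map_add' x y := by apply ext_coords <;> simp
  map_smul' r x := by apply ext_coords <;> simp

theorem rot_apply (x : Albert) : rot x = ofCoords x.d₂ x.d₃ x.d₁ x.o₂ x.o₃ x.o₁ := rfl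

theorem isSharpPair_rot : IsSharpPair rot rot where
  surjective x := ⟨ofCoords x.d₃ x.d₁ x.d₂ x.o₃ x.o₁ x.o₂, by
    apply ext_coords <;> simp [rot_apply]⟩
  sharp_apply x := by apply ext_coords <;> simp [rot_apply, sharp]
  sharp_apply' x := by apply ext_coords <;> simp [rot_apply, sharp]
  form_apply x y := by simp [rot_apply, form]; ring

/-- The exchange of the first two indices. -/
def swap : Albert →ₗ[ℝ] Albert where
  toFun x := ofCoords x.d₂ x.d₁ x.d₃ (star x.o₂) (star x.o₁) (star x.o₃)
  map_add' x y := by apply ext_coords <;> simp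
  map_smul' r x := by apply ext_coords <;> simp

theorem swap_apply (x : Albert) :
    swap x = ofCoords x.d₂ x.d₁ x.d₃ (star x.o₂) (star x.o₁) (star x.o₃) := rfl

theorem isSharpPair_swap : IsSharpPair swap swap where
  surjective x := ⟨swap x, by apply ext_coords <;> simp [swap_apply]⟩
  sharp_apply x := by apply ext_coords <;> simp [swap_apply, sharp, mul_comm]
  sharp_apply' x := by apply ext_coords <;> simp [swap_apply, sharp, mul_comm]
  form_apply x y := by simp [swap_apply, form]; ring

/-- The map `x ↦ t x t*` for the elementary matrix `t` with entry `u*` in position `(0, 2)`. -/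
def transvection (u : Octonion) : Albert →ₗ[ℝ] Albert where
  toFun x := ofCoords (x.d₁ + 2 * ip u x.o₂ + ip u u * x.d₃) x.d₂ x.d₃
    x.o₁ (x.o₂ + x.d₃ • u) (x.o₃ + star (x.o₁ * u))
  map_add' x y := by
    apply ext_coords <;> simp [mul_add]
    on_goal 1 => ring
    all_goals module
  map_smul' r x := by
    apply ext_coords <;> simp [smul_mul_assoc]
    on_goal 1 => ring
    all_goals module

theorem transvection_apply (u : Octonion) (x : Albert) : transvection u x =
    ofCoords (x.d₁ + 2 * ip u x.o₂ + ip u u * x.d₃) x.d₂ x.d₃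
      x.o₁ (x.o₂ + x.d₃ • u) (x.o₃ + star (x.o₁ * u)) := rfl

/-- The map `x ↦ t x t*` for the elementary matrix `t` with entry `-u` in position `(2, 0)`. -/
def dualTransvection (u : Octonion) : Albert →ₗ[ℝ] Albert where
  toFun x := ofCoords x.d₁ x.d₂ (x.d₃ - 2 * ip u x.o₂ + ip u u * x.d₁)
    (x.o₁ - star (u * x.o₃)) (x.o₂ - x.d₁ • u) x.o₃
  map_add' x y := by
    apply ext_coords <;> simp [add_mul]
    on_goal 1 => ring
    all_goals module
  map_smul' r x := by
    apply ext_coords <;> simp [mul_smul_comm]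
    on_goal 1 => ring
    all_goals module

theorem dualTransvection_apply (u : Octonion) (x : Albert) : dualTransvection u x =
    ofCoords x.d₁ x.d₂ (x.d₃ - 2 * ip u x.o₂ + ip u u * x.d₁)
      (x.o₁ - star (u * x.o₃)) (x.o₂ - x.d₁ • u) x.o₃ := rfl

theorem isSharpPair_transvection (u : Octonion) :
    IsSharpPair (transvection u) (dualTransvection u) where
  surjective x := ⟨transvection (-u) x, by
    apply ext_coords <;> simp [transvection_apply]
    ring⟩
  sharp_apply x := by
    have c := ip_comm x.o₂ u
    have k := ip_comm x.o₃ (star (x.o₁ * u))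
    have k' := ip_mul_star x.o₃ x.o₁ u
    have e₁ := mul_mul_star_add x.o₁ x.o₂ u
    have e₁' := mul_mul_star_self x.o₁ u
    have e₂ := star_mul_mul_self x.o₁ u
    apply ext_coords <;> simp only [transvection_apply, dualTransvection_apply, sharp, d₁_ofCoords,
      d₂_ofCoords, d₃_ofCoords, o₁_ofCoords, o₂_ofCoords, o₃_ofCoords, ip_add_left, ip_add_right,
      ip_smul_left, ip_smul_right, ip_sub_right, ip_star_star, ip_mul_self, mul_add, add_mul,
      mul_sub, star_add, star_sub, smul_mul_assoc, mul_smul_comm, star_smul, star_trivial,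
      star_star, star_mul u (star _), star_mul (star _) x.o₁,
      star_mul x.o₂ (star _)]
    · linear_combination (-x.d₃) * c
    · linear_combination (-2) * k' + k
    · rw [c] at e₁
      linear_combination (norm := module) e₁ + x.d₃ • e₁'
    · linear_combination (norm := module) e₂
    · module
  sharp_apply' x := by
    have c := ip_comm x.o₂ u
    have k := ip_comm x.o₁ (star (u * x.o₃))
    have k' := ip_mul_star x.o₁ u x.o₃
    have k'' := ip_mul_star x.o₃ x.o₁ u
    have e₂ := mul_mul_star_self u x.o₃
    have e₃ := star_mul_mul_add x.o₂ u x.o₃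
    have e₃' := star_mul_mul_self u x.o₃
    apply ext_coords <;> simp only [transvection_apply, dualTransvection_apply, sharp, d₁_ofCoords,
      d₂_ofCoords, d₃_ofCoords, o₁_ofCoords, o₂_ofCoords, o₃_ofCoords,
      ip_smul_left, ip_smul_right, ip_sub_left, ip_sub_right, ip_star_star, ip_mul_self,
      sub_mul, mul_sub, star_sub, smul_mul_assoc, mul_smul_comm, star_smul, star_trivial, star_star,
      star_mul (star _) x.o₂, star_mul (star _) u, star_mul x.o₃ (star _)]
    · linear_combination 2 * k' - k + 2 * k''
    · linear_combination x.d₁ * c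
    · module
    · linear_combination (norm := module) -e₂
    · rw [c] at e₃
      linear_combination (norm := module) -e₃ + x.d₁ • e₃'
  form_apply x y := by
    have c := ip_comm x.o₂ u
    have k := ip_mul_star x.o₃ y.o₁ u
    have k' := ip_mul_star u x.o₃ y.o₁
    have k'' := ip_comm y.o₁ (star (u * x.o₃))
    simp only [transvection_apply, dualTransvection_apply, form, d₁_ofCoords,
      d₂_ofCoords, d₃_ofCoords, o₁_ofCoords, o₂_ofCoords, o₃_ofCoords, ip_add_right,
      ip_smul_left, ip_smul_right, ip_sub_left]
    linear_combination 2 * y.d₃ * c + 2 * k + 2 * k' + 2 * k''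

/-- An element with nonzero last diagonal entry can be freed of the two off-diagonal entries next
to it. -/
theorem exists_isSharpPair_clear {y : Albert} (hy : y.d₃ ≠ 0) :
    ∃ g g' : Albert →ₗ[ℝ] Albert, IsSharpPair g g' ∧ (g y).d₃ ≠ 0 ∧ (g y).o₁ = 0 ∧ (g y).o₂ = 0 ∧
      ∀ z, z.d₃ = 0 → z.o₁ = 0 → z.o₂ = 0 → g z = z := by
  have one : ∀ y : Albert, y.d₃ ≠ 0 → ∃ g g' : Albert →ₗ[ℝ] Albert, IsSharpPair g g' ∧
      (g y).d₃ = y.d₃ ∧ (g y).o₁ = y.o₁ ∧ (g y).o₂ = 0 ∧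
      ∀ z, z.d₃ = 0 → z.o₁ = 0 → z.o₂ = 0 → g z = z := fun y hy => by
    refine ⟨_, _, isSharpPair_transvection (-y.d₃⁻¹ • y.o₂), ?_, rfl, ?_, fun z h₁ h₂ h₃ => ?_⟩
    · simp [transvection_apply]
    · simp [transvection_apply, smul_smul, hy]
    · apply ext_coords <;> simp [transvection_apply, h₁, h₂, h₃]
  obtain ⟨f, f', hf, a₁, a₂, a₃, a₄⟩ := one y hy
  obtain ⟨k, k', hk, b₁, b₂, b₃, b₄⟩ := one (swap (f y)) (by simpa [swap_apply, a₁] using hy)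
  refine ⟨_, _, isSharpPair_swap.comp (hk.comp (isSharpPair_swap.comp hf)), ?_, ?_, ?_,
    fun z h₁ h₂ h₃ => ?_⟩
  · have e : ∀ z, (swap z).d₃ = z.d₃ := fun z => d₃_ofCoords ..
    simp only [LinearMap.comp_apply]
    rwa [e, b₁, e, a₁]
  · change star (k (swap (f y))).o₂ = 0
    rw [b₃, star_zero]
  · change star (k (swap (f y))).o₁ = 0
    rw [b₂]
    change star (star (f y).o₂) = 0
    rw [a₃, star_zero, star_zero]
  · simp only [LinearMap.comp_apply]
    rw [a₄ z h₁ h₂ h₃, b₄ _ (by simpa [swap_apply] using h₁) (by simpa [swap_apply] using h₃)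
      (by simpa [swap_apply] using h₂)]
    apply ext_coords <;> simp [swap_apply]

end Albert

/-! ### Subspaces of octonions stable under the three products -/

namespace Octonion

theorem mul_star_mul_add (z b c : Octonion) :
    (z * star b) * c + (z * star c) * b = (2 * ip b c) • z := by
  simpa using mul_mul_star_add z (star b) (star c)

theorem finrank_eq_eight : Module.finrank ℝ Octonion = 8 := by
  let e : Octonion ≃ₗ[ℝ] Quaternion ℝ × Quaternion ℝ :=
    { toFun := fun x => (x.fst, x.snd)
      invFun := fun x => ⟨x.1, x.2⟩
      map_add' := fun _ _ => rfl
      map_smul' := fun _ _ => rfl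
      left_inv := fun _ => rfl
      right_inv := fun _ => rfl }
  rw [e.finrank_eq, Module.finrank_prod, Quaternion.finrank_eq_four]

/-- Two octonions `s`, `t` span, together with their images under `J r = x* (y r)`, a subspace
stable under `J`, because `J` is a root of a real quadratic polynomial. -/
def doubledSpan (x y s t : Octonion) : Submodule ℝ Octonion :=
  Submodule.span ℝ {s, t, star x * (y * s), star x * (y * t)}

theorem doubledSpan_ne_top (x y s t : Octonion) : doubledSpan x y s t ≠ ⊤ := by
  classical
  intro h
  have h₁ := finrank_span_finset_le_card (R := ℝ)
    ({s, t, star x * (y * s), star x * (y * t)} : Finset Octonion)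
  have h₂ := Finset.card_le_four (a := s) (b := t) (c := star x * (y * s)) (d := star x * (y * t))
  simp only [Finset.coe_insert, Finset.coe_singleton] at h₁
  rw [doubledSpan] at h
  rw [Set.finrank, h, finrank_top, finrank_eq_eight] at h₁
  omega

section
variable {x y s t : Octonion}

theorem doubledSpan_induction {N : Submodule ℝ Octonion} (f : Octonion →ₗ[ℝ] Octonion)
    (h₁ : f s ∈ N) (h₂ : f t ∈ N) (h₃ : f (star x * (y * s)) ∈ N) (h₄ : f (star x * (y * t)) ∈ N)
    {r : Octonion} (hr : r ∈ doubledSpan x y s t) : f r ∈ N := by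
  have : doubledSpan x y s t ≤ N.comap f := by
    refine Submodule.span_le.mpr ?_
    rintro z (rfl | rfl | rfl | rfl) <;> assumption
  exact this hr

theorem left_mem_doubledSpan : s ∈ doubledSpan x y s t :=
  Submodule.subset_span (by simp)

theorem right_mem_doubledSpan : t ∈ doubledSpan x y s t :=
  Submodule.subset_span (by simp)

theorem star_mul_mul_left_mem : star x * (y * s) ∈ doubledSpan x y s t :=
  Submodule.subset_span (by simp)

theorem star_mul_mul_right_mem : star x * (y * t) ∈ doubledSpan x y s t :=
  Submodule.subset_span (by simp)

theorem star_mul_mul_mem_doubledSpan {r : Octonion} (hr : r ∈ doubledSpan x y s t) :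
    star x * (y * r) ∈ doubledSpan x y s t := by
  have quad : ∀ z, star x * (y * (star x * (y * z))) =
      (2 * ip x y) • (star x * (y * z)) - (ip x x * ip y y) • z := fun z => by
    have h := star_mul_mul_add (star x) (star y) (y * z)
    rw [star_star, star_star, star_mul_mul_self, ip_star_star, mul_smul_comm] at h
    rw [eq_sub_of_add_eq' h, mul_sub, mul_smul_comm, mul_smul_comm, star_mul_mul_self, smul_smul]
    module
  refine doubledSpan_induction (LinearMap.mulLeft ℝ (star x) ∘ₗ LinearMap.mulLeft ℝ y)
    star_mul_mul_left_mem star_mul_mul_right_mem ?_ ?_ hr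
  · change star x * (y * (star x * (y * s))) ∈ _
    rw [quad]
    exact Submodule.sub_mem _ (Submodule.smul_mem _ _ star_mul_mul_left_mem)
      (Submodule.smul_mem _ _ left_mem_doubledSpan)
  · change star x * (y * (star x * (y * t))) ∈ _
    rw [quad]
    exact Submodule.sub_mem _ (Submodule.smul_mem _ _ star_mul_mul_right_mem)
      (Submodule.smul_mem _ _ right_mem_doubledSpan)

theorem mul_mem_map_mulLeft (hx : x ≠ 0) {r : Octonion} (hr : r ∈ doubledSpan x y s t) :
    y * r ∈ (doubledSpan x y s t).map (LinearMap.mulLeft ℝ x) := by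
  refine ⟨(ip x x)⁻¹ • (star x * (y * r)),
    Submodule.smul_mem _ _ (star_mul_mul_mem_doubledSpan hr), ?_⟩
  have h := star_mul_mul_self (star x) (y * r)
  rw [star_star, ip_star_star] at h
  rw [LinearMap.mulLeft_apply, mul_smul_comm, h, inv_smul_smul₀ (ip_self_pos hx).ne']

/-- Modulo `x S`, where `S` is the doubled span, the product `((x a) b*) c` is an alternating
function of `a`, `b` and `c` in `S`. It vanishes if two of the arguments are `r` and `J r`, and any
three of the four vectors that span `S` contain such a pair. -/
theorem mul_star_mul_mem_map_mulLeft (hx : x ≠ 0) {a b c : Octonion}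
    (ha : a ∈ doubledSpan x y s t) (hb : b ∈ doubledSpan x y s t) (hc : c ∈ doubledSpan x y s t) :
    ((x * a) * star b) * c ∈ (doubledSpan x y s t).map (LinearMap.mulLeft ℝ x) := by
  set S := doubledSpan x y s t
  set M := S.map (LinearMap.mulLeft ℝ x)
  set js := star x * (y * s)
  set jt := star x * (y * t)
  have ms : s ∈ S := left_mem_doubledSpan
  have mt : t ∈ S := right_mem_doubledSpan
  have mjs : js ∈ S := star_mul_mul_left_mem
  have mjt : jt ∈ S := star_mul_mul_right_mem
  let T : Octonion → Octonion → Octonion → Prop := fun a b c => ((x * a) * star b) * c ∈ M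
  have mem : ∀ {r}, r ∈ S → x * r ∈ M := fun hr => ⟨_, hr, rfl⟩
  have s₁ : ∀ {a b c}, c ∈ S → T a b c → T b a c := fun {a b c} hc h => by
    have e := congrArg (· * c) (mul_mul_star_add x a b)
    simp only [add_mul, smul_mul_assoc] at e
    have := M.sub_mem (M.smul_mem (2 * ip a b) (mem hc)) h
    rwa [← eq_sub_of_add_eq' e] at this
  have s₂ : ∀ {a b c}, a ∈ S → T a b c → T a c b := fun {a b c} ha h => by
    have := M.sub_mem (M.smul_mem (2 * ip b c) (mem ha)) h
    rwa [← eq_sub_of_add_eq' (mul_star_mul_add (x * a) b c)] at this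
  have rep : ∀ {a c}, c ∈ S → T a a c := fun {a c} hc => by
    change (x * a) * star a * c ∈ M
    rw [mul_mul_star_self, smul_mul_assoc]
    exact M.smul_mem _ (mem hc)
  have pair : ∀ {a c}, c ∈ S → T a (star x * (y * a)) c := fun {a c} hc => by
    refine s₁ hc ?_
    change (x * (star x * (y * a))) * star a * c ∈ M
    have h := star_mul_mul_self (star x) (y * a)
    rw [star_star] at h
    rw [h, smul_mul_assoc, mul_mul_star_self, smul_mul_assoc, smul_mul_assoc]
    exact M.smul_mem _ (M.smul_mem _ (mul_mem_map_mulLeft hx hc))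
  have rep' : ∀ {a b}, a ∈ S → b ∈ S → T a b b := fun ha hb => s₁ hb (s₂ hb (rep ha))
  have lin : ∀ {a b}, T a b s → T a b t → T a b js → T a b jt → ∀ {c}, c ∈ S → T a b c :=
    fun {a b} h₁ h₂ h₃ h₄ {c} hc =>
      doubledSpan_induction (LinearMap.mulLeft ℝ (x * a * star b)) h₁ h₂ h₃ h₄ hc
  have lin₂ : ∀ {a}, a ∈ S → (∀ {c}, c ∈ S → T a s c) → (∀ {c}, c ∈ S → T a t c) →
      (∀ {c}, c ∈ S → T a js c) → (∀ {c}, c ∈ S → T a jt c) →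
      ∀ {b c}, b ∈ S → c ∈ S → T a b c :=
    fun {a} ha h₁ h₂ h₃ h₄ {b c} hb hc =>
      lin (s₂ ha (h₁ hb)) (s₂ ha (h₂ hb)) (s₂ ha (h₃ hb)) (s₂ ha (h₄ hb)) hc
  have st : ∀ {c}, c ∈ S → T s t c := lin (s₂ ms (rep mt)) (rep' ms mt) (s₂ ms (pair mt))
    (s₁ mjt (s₂ mt (pair ms)))
  have sjt : ∀ {c}, c ∈ S → T s jt c := lin (s₂ ms (rep mjt)) (s₂ ms (st mjt))
    (s₂ ms (pair mjt)) (rep' ms mjt)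
  have Ts : ∀ {b c}, b ∈ S → c ∈ S → T s b c := lin₂ ms rep st pair sjt
  have tjs : ∀ {c}, c ∈ S → T t js c := lin (s₂ mt (s₁ mjs (st mjs))) (s₂ mt (rep mjs))
    (rep' mt mjs) (s₂ mt (pair mjs))
  have Tt : ∀ {b c}, b ∈ S → c ∈ S → T t b c :=
    lin₂ mt (fun hc => s₁ hc (st hc)) rep tjs pair
  have jsjt : ∀ {c}, c ∈ S → T js jt c := lin (s₂ mjs (s₁ mjt (Ts mjs mjt)))
    (s₂ mjs (s₁ mjt (Tt mjs mjt))) (s₂ mjs (rep mjt)) (rep' mjs mjt)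
  have Tjs : ∀ {b c}, b ∈ S → c ∈ S → T js b c :=
    lin₂ mjs (fun hc => s₁ hc (Ts mjs hc)) (fun hc => s₁ hc (Tt mjs hc)) rep jsjt
  have Tjt : ∀ {b c}, b ∈ S → c ∈ S → T jt b c :=
    lin₂ mjt (fun hc => s₁ hc (Ts mjt hc)) (fun hc => s₁ hc (Tt mjt hc))
      (fun hc => s₁ hc (jsjt hc)) rep
  exact s₁ hc (lin₂ hb (fun hc => s₁ hc (Ts hb hc)) (fun hc => s₁ hc (Tt hb hc))
    (fun hc => s₁ hc (Tjs hb hc)) (fun hc => s₁ hc (Tjt hb hc)) ha hc)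

/-- Four octonions, two of them in the same off-diagonal position, lie in three subspaces, the first
of them proper, that are stable under the products `(a, b) ↦ (a b)*` between different positions. -/
theorem exists_stable_triple (hx : x ≠ 0) (y z w : Octonion) :
    ∃ X₁ X₂ X₃ : Submodule ℝ Octonion, X₁ ≠ ⊤ ∧ z ∈ X₁ ∧ w ∈ X₂ ∧ x ∈ X₃ ∧ y ∈ X₃ ∧
      (∀ a ∈ X₂, ∀ b ∈ X₃, star (a * b) ∈ X₁) ∧ (∀ a ∈ X₃, ∀ b ∈ X₁, star (a * b) ∈ X₂) ∧
      (∀ a ∈ X₁, ∀ b ∈ X₂, star (a * b) ∈ X₃) := by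
  -- The second spanning vector is chosen such that `x t = w*`.
  set t := (ip x x)⁻¹ • (star x * star w) with ht
  set S := doubledSpan x y z t
  set M := S.map (LinearMap.mulLeft ℝ x)
  let X₂ : Submodule ℝ Octonion :=
    { carrier := {v | star v ∈ M}
      zero_mem' := by simp
      add_mem' := fun {a b} ha hb => by
        rw [Set.mem_ofPred_eq, star_add]; exact M.add_mem ha hb
      smul_mem' := fun r a ha => by
        rw [Set.mem_ofPred_eq, star_smul]; exact M.smul_mem _ ha }
  let X₃ : Submodule ℝ Octonion :=
    { carrier := {v | ∀ r ∈ S, v * r ∈ M}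
      zero_mem' := fun r _ => by simp
      add_mem' := fun {a b} ha hb r hr => by
        rw [add_mul]; exact M.add_mem (ha r hr) (hb r hr)
      smul_mem' := fun k a ha r hr => by
        rw [smul_mul_assoc]; exact M.smul_mem _ (ha r hr) }
  refine ⟨S, X₂, X₃, doubledSpan_ne_top _ _ _ _, left_mem_doubledSpan, ?_, fun r hr => ⟨r, hr, rfl⟩,
    fun r hr => mul_mem_map_mulLeft hx hr, ?_, ?_, ?_⟩
  · refine ⟨t, right_mem_doubledSpan, ?_⟩
    have h := star_mul_mul_self (star x) (star w)
    rw [star_star, ip_star_star] at h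
    rw [LinearMap.mulLeft_apply, ht, mul_smul_comm, h, inv_smul_smul₀ (ip_self_pos hx).ne']
  · rintro a ⟨r, hr, e⟩ b hb
    obtain ⟨r', hr', e'⟩ := hb r hr
    rw [LinearMap.mulLeft_apply] at e e'
    rw [star_mul, ← e, eq_sub_of_add_eq (star_mul_mul_add b x r), ← e', star_mul_mul_self]
    exact S.sub_mem (S.smul_mem _ hr) (S.smul_mem _ hr')
  · intro a ha b hb
    change star (star (a * b)) ∈ M
    rw [star_star]
    exact ha b hb
  · rintro a ha b ⟨r, hr, e⟩ c hc
    rw [LinearMap.mulLeft_apply] at e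
    rw [star_mul, ← e]
    exact mul_star_mul_mem_map_mulLeft hx hr ha hc

end
end Octonion

/-! ### Reduction to block form -/

namespace Albert
open Octonion

/-- The case in which `p` and `q` are diagonal and `h` is block diagonal: all four elements then
have their off-diagonal entries in three subspaces of octonions that are stable under products. -/
theorem caged_of_block {h a p q : Albert} (h₁ : h.o₁ = 0) (h₂ : h.o₂ = 0) (p₁ : p.o₁ = 0)
    (p₂ : p.o₂ = 0) (p₃ : p.o₃ = 0) (q₁ : q.o₁ = 0) (q₂ : q.o₂ = 0) (q₃ : q.o₃ = 0) :
    Caged h a p q := by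
  -- If `h` is diagonal, any nonzero octonion can take the place of its off-diagonal entry.
  obtain ⟨x, hx, hx'⟩ : ∃ x : Octonion, x ≠ 0 ∧ (h.o₃ = 0 ∨ h.o₃ = x) := by
    by_cases e : h.o₃ = 0
    · exact ⟨1, fun e' => (one_ne_zero : (1 : ℝ) ≠ 0)
        (congrArg (fun z : Octonion => z.fst.re) e'), Or.inl e⟩
    · exact ⟨_, e, Or.inr rfl⟩
  obtain ⟨X₁, X₂, X₃, ne, m₁, m₂, mx, m₃, c₁, c₂, c₃⟩ :=
    exists_stable_triple hx a.o₃ a.o₁ a.o₂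
  let B : Submodule ℝ Albert :=
    { carrier := {v | v.o₁ ∈ X₁ ∧ v.o₂ ∈ X₂ ∧ v.o₃ ∈ X₃}
      zero_mem' := ⟨X₁.zero_mem, X₂.zero_mem, X₃.zero_mem⟩
      add_mem' := fun h k => ⟨X₁.add_mem h.1 k.1, X₂.add_mem h.2.1 k.2.1, X₃.add_mem h.2.2 k.2.2⟩
      smul_mem' := fun r _ h => ⟨X₁.smul_mem r h.1, X₂.smul_mem r h.2.1, X₃.smul_mem r h.2.2⟩ }
  have hB : ∀ v ∈ B, sharp v ∈ B := fun v hv =>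
    ⟨X₁.sub_mem (c₁ _ hv.2.1 _ hv.2.2) (X₁.smul_mem _ hv.1),
      X₂.sub_mem (c₂ _ hv.2.2 _ hv.1) (X₂.smul_mem _ hv.2.1),
      X₃.sub_mem (c₃ _ hv.1 _ hv.2.1) (X₃.smul_mem _ hv.2.2)⟩
  refine ⟨B, B, fun e => ne (eq_top_iff.mpr fun r _ => ?_), hB, hB, ⟨?_, ?_, ?_⟩,
    ⟨m₁, m₂, m₃⟩, ⟨?_, ?_, ?_⟩, ⟨?_, ?_, ?_⟩⟩
  · have : ofCoords 0 0 0 r 0 0 ∈ B := e ▸ Submodule.mem_top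
    exact this.1
  · exact h₁ ▸ X₁.zero_mem
  · exact h₂ ▸ X₂.zero_mem
  · rcases hx' with e | e
    · exact e ▸ X₃.zero_mem
    · exact e ▸ mx
  · exact p₁ ▸ X₁.zero_mem
  · exact p₂ ▸ X₂.zero_mem
  · exact p₃ ▸ X₃.zero_mem
  · exact q₁ ▸ X₁.zero_mem
  · exact q₂ ▸ X₂.zero_mem
  · exact q₃ ▸ X₃.zero_mem

/-- An element of rank one without off-diagonal entries in the last row is a multiple of the last
diagonal matrix unit. -/
theorem eq_zero_of_sharp_eq_zero {x : Albert} (hx : sharp x = 0) (h₃ : x.d₃ ≠ 0) (h₁ : x.o₁ = 0)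
    (h₂ : x.o₂ = 0) : x.d₁ = 0 ∧ x.d₂ = 0 ∧ x.o₃ = 0 := by
  have e₁ := congrArg d₁ hx
  have e₂ := congrArg d₂ hx
  have e₃ := congrArg o₃ hx
  simp [sharp, h₁, h₂, h₃] at e₁ e₂ e₃
  exact ⟨e₂, e₁, e₃⟩

/-- The case in which `p` and `q` are multiples of the first two diagonal matrix units. -/
theorem caged_of_diagonal {h a p q : Albert} (H : Nondegenerate h p q)
    (p₁ : p.o₁ = 0) (p₂ : p.o₂ = 0) (p₃ : p.o₃ = 0) (q₁ : q.o₁ = 0) (q₂ : q.o₂ = 0) (q₃ : q.o₃ = 0)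
    (pd : p.d₃ = 0) (qd : q.d₃ = 0) : Caged h a p q := by
  have hd : h.d₃ ≠ 0 := fun e => H.2.2 (by
    simp [form, sharp, p₁, p₂, p₃, q₁, q₂, q₃, pd, qd, e])
  obtain ⟨g, g', hg, -, k₁, k₂, k₃⟩ := exists_isSharpPair_clear hd
  refine hg.caged ?_
  rw [k₃ p pd p₁ p₂, k₃ q qd q₁ q₂]
  exact caged_of_block k₁ k₂ p₁ p₂ p₃ q₁ q₂ q₃

/-- The case in which `p` is a multiple of the first diagonal matrix unit and `q` has a nonzero last
diagonal entry. -/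
theorem caged_of_first {h a p q : Albert} (H : Nondegenerate h p q) (p₁ : p.o₁ = 0)
    (p₂ : p.o₂ = 0) (p₃ : p.o₃ = 0) (pd₂ : p.d₂ = 0) (pd₃ : p.d₃ = 0) (qd : q.d₃ ≠ 0) :
    Caged h a p q := by
  obtain ⟨g, g', hg, k, k₁, k₂, k₃⟩ := exists_isSharpPair_clear qd
  refine hg.caged (isSharpPair_rot.caged ?_)
  have H' := hg.nondegenerate H
  obtain ⟨z₁, z₂, z₃⟩ := eq_zero_of_sharp_eq_zero H'.2.1 k k₁ k₂
  have H'' := isSharpPair_rot.nondegenerate H'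
  rw [k₃ p pd₃ p₁ p₂] at H'' ⊢
  -- It takes two shifts to bring `p` and `q` to the first two diagonal positions.
  have H''' := isSharpPair_rot.nondegenerate H''
  refine isSharpPair_rot.caged (caged_of_diagonal H''' ?_ ?_ ?_ ?_ ?_ ?_ ?_ ?_) <;>
    simp [rot_apply, *]

theorem off_diagonal_eq_zero {x : Albert} (hx : sharp x = 0) (h₁ : x.d₁ = 0) (h₂ : x.d₂ = 0) :
    x.o₁ = 0 ∧ x.o₂ = 0 ∧ x.o₃ = 0 := by
  have e₁ := congrArg d₁ hx
  have e₂ := congrArg d₂ hx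
  have e₃ := congrArg d₃ hx
  simp [sharp, h₁, h₂, ip_self_eq_zero] at e₁ e₂ e₃
  exact ⟨e₁, e₂, e₃⟩

theorem caged_of_last {h a p q : Albert} (H : Nondegenerate h p q) (pd : p.d₃ ≠ 0) :
    Caged h a p q := by
  obtain ⟨g, g', hg, k, k₁, k₂, k₃⟩ := exists_isSharpPair_clear pd
  refine hg.caged ?_
  have H' := hg.nondegenerate H
  obtain ⟨z₁, z₂, z₃⟩ := eq_zero_of_sharp_eq_zero H'.1 k k₁ k₂
  have step : ∀ {h a p q : Albert}, Nondegenerate h p q → p.o₁ = 0 → p.o₂ = 0 → p.o₃ = 0 →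
      p.d₁ = 0 → p.d₂ = 0 → q.d₂ ≠ 0 → Caged h a p q := fun H p₁ p₂ p₃ d₁ d₂ hq => by
    refine isSharpPair_rot.caged (isSharpPair_rot.caged (caged_of_first
      (isSharpPair_rot.nondegenerate (isSharpPair_rot.nondegenerate H)) ?_ ?_ ?_ ?_ ?_ ?_)) <;>
      simpa [rot_apply]
  by_cases e₂ : (g q).d₂ = 0
  · by_cases e₁ : (g q).d₁ = 0
    · obtain ⟨y₁, y₂, y₃⟩ := off_diagonal_eq_zero H'.2.1 e₁ e₂
      refine (H'.2.2 ?_).elim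
      simp [form, sharp, *]
    · refine isSharpPair_swap.caged (step (isSharpPair_swap.nondegenerate H') ?_ ?_ ?_ ?_ ?_ ?_) <;>
        simpa [swap_apply]
  · exact step H' k₁ k₂ z₃ z₁ z₂ e₂

theorem Nondegenerate.caged {h p q : Albert} (H : Nondegenerate h p q) (a : Albert) :
    Caged h a p q := by
  by_cases e₃ : p.d₃ = 0
  · by_cases e₂ : p.d₂ = 0
    · by_cases e₁ : p.d₁ = 0
      · obtain ⟨y₁, y₂, y₃⟩ := off_diagonal_eq_zero H.1 e₁ e₂
        have hp : p = 0 := ext_coords e₁ e₂ e₃ y₁ y₂ y₃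
        refine (H.2.2 ?_).elim
        rw [hp, zero_add, H.2.1]
        simp [form]
      · exact isSharpPair_rot.caged (caged_of_last (isSharpPair_rot.nondegenerate H)
          (by simpa [rot_apply] using e₁))
    · have H' := isSharpPair_rot.nondegenerate (isSharpPair_rot.nondegenerate H)
      exact isSharpPair_rot.caged (isSharpPair_rot.caged (caged_of_last H'
        (by simpa [rot_apply] using e₂)))
  · exact caged_of_last H e₃

end Albert

end

/-- No three elements `a, p, q` of the Albert algebra with `p` and `q` projections generate it,
together with the unit, as a real Jordan algebra. -/
theorem mainTheorem7 (a p q : Albert) (hp : p * p = p) (hq : q * q = q) :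
    NonUnitalAlgebra.adjoin ℝ ({1, a, p, q} : Set Albert) ≠ ⊤ :=
  Albert.adjoin_ne_top_of_forall_caged (fun _ a _ _ H => H.caged a) a p q hp hq
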